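/- Let $(X,\mathscr A,\mu)$ be a $\sigma$-finite measure space and let $\phi\colon X\to X$ be a measurable map with $\mu\circ\phi^{-1}\ll\mu$; put $\mathsf h_\phi=\frac{\mathrm d(\mu\circ\phi^{-1})}{\mathrm d\mu}\colon X\to[0,\infty]$. For a measurable $w\colon X\to\mathbb C$ let $C_{\phi,w}$ be the weighted composition operator in the complex space $L^2(\mu)$ given by $\mathcal D(C_{\phi,w})=\{f\in L^2(\mu): w\cdot(f\circ\phi)\in L^2(\mu)\}$ and $C_{\phi,w}f=w\cdot(f\circ\phi)$, and let $C_\phi=C_{\phi,\mathbf 1}$ be the composition operator. For $f\in L^2(\mu)$ let $\mathsf E_\phi(f)$ be the conditional expectation of $f$ with respect to the $\sigma$-algebra $\phi^{-1}(\mathscr A)$ and the measure $\mu$, and let $\mathsf E_\phi(f)\circ\phi^{-1}$ denote the ($\mu$-a.e. unique) $\mathscr A$-measurable function $g$ on $X$ with $g=0$ a.e. $[\mu]$ on $\{\mathsf h_\phi=0\}$ and $g\circ\phi=\mathsf E_\phi(f)$ a.e. $[\mu]$. For an operator $T$ in a Hilbert space with domain $\mathcal D(T)$, kernel $\mathcal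 N(T)$ and range $\mathcal R(T)$ such that $\mathcal D(T)=\mathcal N(T)\oplus(\mathcal D(T)\cap\mathcal N(T)^\perp)$, the reciprocal $T^\dagger$ is the unique operator with domain $\mathcal R(T)\oplus\mathcal R(T)^\perp$ and kernel $\mathcal R(T)^\perp$ such that $TT^\dagger f=P_{\overline{\mathcal R(T)}}f$ for $f\in\mathcal D(T^\dagger)$ and $T^\dagger Tg=P_{\mathcal N(T)^\perp}g$ for $g\in\mathcal D(T)$. Assume that $C_\phi$ is densely defined in $L^2(\mu)$. Then the reciprocals of $C_\phi$ and of its adjoint $C_\phi^*$ exist, and: (i) $\mathcal D(C_\phi^\dagger)=\{f\in L^2(\mu): \mathsf E_\phi(f)\circ\phi^{-1}\in L^2(\mu)\}$ and $C_\phi^\dagger f=\mathsf E_\phi(f)\circ\phi^{-1}$ for every $f\in\mathcal D(C_\phi^\dagger)$; (ii) $(C_\phi^*)^\dagger=C_{\phi,\,\mathsf h_\phi^{-1}\circ\phi}$, with equality of domains; here the weight is $1/\mathsf h_\phi(\phi(x))$, set to be $0$ on the $\mu$-null set of $x$ with $\mathsf h_\phi(\phi(x))\in\{0,\infty\}$.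 -/

import Mathlib

open scoped ENNReal
open MeasureTheory

namespace Recip

noncomputable section

section Hilbert

variable {H : Type*} [NormedAddCommGroup H] [InnerProductSpace ℂ H]

/-- The kernel of a partially defined operator, as a subspace of the ambient space. -/
def ker (T : H →ₗ.[ℂ] H) : Submodule ℂ H :=
  (LinearMap.ker T.toFun).map T.domain.subtype

/-- The range of a partially defined operator. -/
def ran (T : H →ₗ.[ℂ] H) : Submodule ℂ H :=
  LinearMap.range T.toFun

theorem mem_ker (T : H →ₗ.[ℂ] H) {x : H} : x ∈ ker T ↔ ∃ u : T.domain, (u : H) = x ∧ T u = 0 := by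
  constructor
  · rintro ⟨u, hu, rfl⟩
    exact ⟨u, rfl, hu⟩
  · rintro ⟨u, rfl, hu⟩
    exact ⟨u, hu, rfl⟩

theorem mem_ran (T : H →ₗ.[ℂ] H) {x : H} : x ∈ ran T ↔ ∃ u : T.domain, T u = x := Iff.rfl

/-- The condition `D(T) = N(T) ⊕ (D(T) ∩ N(T)ᗮ)` under which `T` has a reciprocal
(the sum is automatically orthogonal). -/
def HasReciprocal (T : H →ₗ.[ℂ] H) : Prop :=
  T.domain = ker T ⊔ (T.domain ⊓ (ker T)ᗮ)

/-- `S` satisfies the defining properties of the reciprocal of `T`: its domain is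
`R(T) ⊕ R(T)ᗮ`, `T S` is the projection onto the closure of `R(T)` on `D(S)`, `S T` is the
projection onto `N(T)ᗮ` on `D(T)`, and `N(S) = R(T)ᗮ`. -/
structure IsReciprocal [CompleteSpace H] (T S : H →ₗ.[ℂ] H) : Prop where
  domain_eq : S.domain = ran T ⊔ (ran T)ᗮ
  apply_right : ∀ f : S.domain, ∃ hf : S f ∈ T.domain,
    T ⟨S f, hf⟩ = (ran T).topologicalClosure.starProjection (f : H)
  apply_left : ∀ g : T.domain, ∃ hg : T g ∈ S.domain,
    S ⟨T g, hg⟩ = (ker T)ᗮ.starProjection (g : H)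
  ker_eq : ker S = (ran T)ᗮ

/-- The graph of the reciprocal: the pairs `(f, u)` with `u ∈ D(T) ∩ N(T)ᗮ` and
`f - T u ∈ R(T)ᗮ`. -/
def reciprocalGraph (T : H →ₗ.[ℂ] H) : Submodule ℂ (H × H) where
  carrier := {p | ∃ u : T.domain, (u : H) = p.2 ∧ p.2 ∈ (ker T)ᗮ ∧ p.1 - T u ∈ (ran T)ᗮ}
  zero_mem' := ⟨0, by simp⟩
  add_mem' := by
    rintro ⟨a, b⟩ ⟨c, d⟩ ⟨u, hu, hb, ha⟩ ⟨v, hv, hd, hc⟩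
    refine ⟨u + v, by simp [hu, hv], add_mem hb hd, ?_⟩
    have := add_mem ha hc
    simp only [LinearPMap.map_add, Prod.mk_add_mk]
    convert this using 1
    abel
  smul_mem' := by
    rintro c ⟨a, b⟩ ⟨u, hu, hb, ha⟩
    refine ⟨c • u, by simp [hu], Submodule.smul_mem _ c hb, ?_⟩
    have := Submodule.smul_mem _ c ha
    simpa only [LinearPMap.map_smul, Prod.smul_mk, smul_sub] using this

/-- The reciprocal of `T`. It sends `T u + v` to `u`, for `u ∈ D(T) ∩ N(T)ᗮ` and `v ∈ R(T)ᗮ`. -/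
def reciprocal (T : H →ₗ.[ℂ] H) : H →ₗ.[ℂ] H :=
  (reciprocalGraph T).toLinearPMap

theorem reciprocalGraph_isGraph (T : H →ₗ.[ℂ] H) (x : H × H) (hx : x ∈ reciprocalGraph T)
    (hx0 : x.1 = 0) : x.2 = 0 := by
  obtain ⟨u, hu, h1, h2⟩ := hx
  have hTu : T u = 0 := by
    rw [hx0, zero_sub, Submodule.neg_mem_iff] at h2
    have := (Submodule.mem_orthogonal _ _).1 h2 (T u) ⟨u, rfl⟩
    exact inner_self_eq_zero.1 this
  have hk : x.2 ∈ ker T := (mem_ker T).2 ⟨u, hu, hTu⟩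
  exact inner_self_eq_zero.1 ((Submodule.mem_orthogonal _ _).1 h1 _ hk)

theorem mem_graph_reciprocal (T : H →ₗ.[ℂ] H) (f g : H) :
    (f, g) ∈ (reciprocal T).graph ↔
      ∃ u : T.domain, (u : H) = g ∧ g ∈ (ker T)ᗮ ∧ f - T u ∈ (ran T)ᗮ := by
  rw [reciprocal, Submodule.toLinearPMap_graph_eq _ (reciprocalGraph_isGraph T)]
  rfl

theorem eq_of_mem_graph {S : H →ₗ.[ℂ] H} {f g : H} (h : (f, g) ∈ S.graph) :
    ∃ hf : f ∈ S.domain, S ⟨f, hf⟩ = g := by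
  obtain ⟨y, rfl, h2⟩ := S.mem_graph_iff.1 h
  exact ⟨y.2, h2⟩

/-- `reciprocal T` has the defining properties of the reciprocal. -/
theorem isReciprocal_reciprocal [CompleteSpace H] {T : H →ₗ.[ℂ] H} (hT : HasReciprocal T) :
    IsReciprocal T (reciprocal T) := by
  have key : ∀ u : T.domain, ∃ u' : T.domain,
      (u' : H) ∈ (ker T)ᗮ ∧ T u' = T u ∧ (u : H) - u' ∈ ker T := by
    intro u
    have hu : (u : H) ∈ ker T ⊔ (T.domain ⊓ (ker T)ᗮ) := by
      exact hT.le u.2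
    obtain ⟨a, ha, b, hb, hab⟩ := Submodule.mem_sup.1 hu
    obtain ⟨a', rfl, ha'⟩ := (mem_ker T).1 ha
    refine ⟨⟨b, hb.1⟩, hb.2, ?_, ?_⟩
    · have : u = a' + ⟨b, hb.1⟩ := Subtype.ext hab.symm
      rw [this, LinearPMap.map_add, ha', zero_add]
    · rw [← hab]
      simpa using ha
  have hgr : ∀ f : (reciprocal T).domain, ∃ u : T.domain, (u : H) = reciprocal T f ∧
      reciprocal T f ∈ (ker T)ᗮ ∧ (f : H) - T u ∈ (ran T)ᗮ := fun f =>
    (mem_graph_reciprocal T _ _).1 ((reciprocal T).mem_graph f)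
  refine ⟨?_, ?_, ?_, ?_⟩
  · ext f
    constructor
    · intro hf
      obtain ⟨u, -, -, h⟩ := hgr ⟨f, hf⟩
      exact Submodule.mem_sup.2 ⟨T u, ⟨u, rfl⟩, f - T u, h, by simp⟩
    · intro hf
      obtain ⟨a, ⟨u, rfl⟩, v, hv, rfl⟩ := Submodule.mem_sup.1 hf
      obtain ⟨u', h1, h2, -⟩ := key u
      refine LinearPMap.mem_domain_iff.2 ⟨u', (mem_graph_reciprocal T _ _).2 ⟨u', rfl, h1, ?_⟩⟩
      rw [h2]
      simpa using hv
  · intro f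
    obtain ⟨u, h1, h2, h3⟩ := hgr f
    refine ⟨h1 ▸ u.2, ?_⟩
    have hu : (⟨reciprocal T f, h1 ▸ u.2⟩ : T.domain) = u := Subtype.ext h1.symm
    rw [hu]
    refine (Submodule.eq_starProjection_of_mem_of_inner_eq_zero
      ((ran T).le_topologicalClosure ⟨u, rfl⟩) ?_).symm
    intro w hw
    rw [← Submodule.orthogonal_closure] at h3
    exact (Submodule.mem_orthogonal' _ _).1 h3 w hw
  · intro g
    obtain ⟨u', h1, h2, h3⟩ := key g
    have hg : (T g, (u' : H)) ∈ (reciprocal T).graph :=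
      (mem_graph_reciprocal T _ _).2 ⟨u', rfl, h1, by simp [h2]⟩
    obtain ⟨hd, he⟩ := eq_of_mem_graph hg
    refine ⟨hd, he.trans ?_⟩
    refine (Submodule.eq_starProjection_of_mem_of_inner_eq_zero h1 ?_).symm
    intro w hw
    exact (Submodule.mem_orthogonal _ _).1 hw _ h3
  · ext f
    rw [mem_ker]
    constructor
    · rintro ⟨f, rfl, hf⟩
      obtain ⟨u, h1, -, h3⟩ := hgr f
      have : u = 0 := Subtype.ext (h1.trans hf)
      simpa [this] using h3
    · intro hf
      have : (f, (0 : H)) ∈ (reciprocal T).graph :=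
        (mem_graph_reciprocal T _ _).2 ⟨0, by simp, zero_mem _, by simpa using hf⟩
      obtain ⟨hd, he⟩ := eq_of_mem_graph this
      exact ⟨⟨f, hd⟩, rfl, he⟩

/-- The defining properties determine the reciprocal. -/
theorem IsReciprocal.unique [CompleteSpace H] {T S S' : H →ₗ.[ℂ] H} (h : IsReciprocal T S)
    (h' : IsReciprocal T S') : S = S' := by
  have hdom : S.domain = S'.domain := h.domain_eq.trans h'.domain_eq.symm
  refine LinearPMap.ext hdom fun f hf hf' => ?_
  have hf2 : f ∈ ran T ⊔ (ran T)ᗮ := h.domain_eq ▸ hf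
  obtain ⟨a, ⟨u, rfl⟩, v, hv, rfl⟩ := Submodule.mem_sup.1 hf2
  have aux : ∀ R : H →ₗ.[ℂ] H, IsReciprocal T R → ∀ hR : T u + v ∈ R.domain,
      R ⟨T u + v, hR⟩ = (ker T)ᗮ.starProjection (u : H) := by
    intro R hTR hR
    obtain ⟨w, hw, hw0⟩ := (mem_ker R).1 (hTR.ker_eq.symm ▸ hv)
    obtain ⟨hg, hg'⟩ := hTR.apply_left u
    have : (⟨T u + v, hR⟩ : R.domain) = ⟨T u, hg⟩ + w := Subtype.ext (by simp [hw])
    rw [this, LinearPMap.map_add, hw0, add_zero, hg']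
  exact (aux S h hf).trans (aux S' h' hf').symm

end Hilbert

section Composition

variable {X : Type*} [MeasurableSpace X]

/-- The measure `μ_w`, with density `|w|²` with respect to `μ`. -/
def weightMeasure (μ : Measure X) (w : X → ℂ) : Measure X :=
  μ.withDensity fun x => ‖w x‖ₑ ^ 2

/-- The condition under which the weighted composition operator `C_{φ,w}` is well defined:
`φ` and `w` are measurable and `μ_w ∘ φ⁻¹ ≪ μ`. -/
structure WellDefined (μ : Measure X) (φ : X → X) (w : X → ℂ) : Prop where
  measurable_map : Measurable φ
  measurable_weight : Measurable w
  absolutelyContinuous : (weightMeasure μ w).map φ ≪ μ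

/-- If `μ ∘ φ⁻¹ ≪ μ`, then `C_{φ,w}` is well defined for every weight. -/
theorem WellDefined.of_quasi {μ : Measure X} {φ : X → X}
    (hφ : Measure.QuasiMeasurePreserving φ μ μ) {w : X → ℂ} (hw : Measurable w) :
    WellDefined μ φ w :=
  ⟨hφ.measurable, hw,
    ((withDensity_absolutelyContinuous μ _).map hφ.measurable).trans hφ.absolutelyContinuous⟩

/-- Under `WellDefined`, the function `w · (f ∘ φ)` depends only on the class of `f`. -/
theorem WellDefined.mul_comp_congr {μ : Measure X} {φ : X → X} {w : X → ℂ}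
    (h : WellDefined μ φ w) {f g : X → ℂ} (hfg : f =ᵐ[μ] g) :
    (fun x => w x * f (φ x)) =ᵐ[μ] fun x => w x * g (φ x) := by
  have h1 : ∀ᵐ x ∂weightMeasure μ w, f (φ x) = g (φ x) :=
    ae_of_ae_map h.measurable_map.aemeasurable (h.absolutelyContinuous.ae_eq hfg)
  rw [weightMeasure, ae_withDensity_iff (by have := h.measurable_weight; fun_prop)] at h1
  filter_upwards [h1] with x hx
  by_cases hw : w x = 0
  · simp [hw]
  · rw [hx (by simpa using hw)]

/-- The weighted composition operator `C_{φ,w} f = w · (f ∘ φ)` in `L²(μ)`, with domain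
`{f ∈ L²(μ) : w · (f ∘ φ) ∈ L²(μ)}`. -/
def weightedComp (μ : Measure X) (φ : X → X) (w : X → ℂ) (h : WellDefined μ φ w) :
    Lp ℂ 2 μ →ₗ.[ℂ] Lp ℂ 2 μ where
  domain :=
    { carrier := {f | MemLp (fun x => w x * f (φ x)) 2 μ}
      zero_mem' := by
        refine (memLp_congr_ae (h.mul_comp_congr (Lp.coeFn_zero ℂ 2 μ))).2 ?_
        simp
      add_mem' := by
        intro f g hf hg
        refine (memLp_congr_ae (h.mul_comp_congr (Lp.coeFn_add f g))).2 ?_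
        simpa only [Pi.add_apply, Pi.add_def, mul_add] using MemLp.add hf hg
      smul_mem' := by
        intro c f hf
        refine (memLp_congr_ae (h.mul_comp_congr (Lp.coeFn_smul c f))).2 ?_
        simpa only [Pi.smul_apply, smul_eq_mul, mul_left_comm] using hf.const_mul c }
  toFun :=
    { toFun := fun f => MemLp.toLp (fun x => w x * (f : Lp ℂ 2 μ) (φ x)) f.2
      map_add' := by
        intro f g
        rw [← MemLp.toLp_add]
        refine (MemLp.toLp_eq_toLp_iff _ _).2
          ((h.mul_comp_congr (Lp.coeFn_add (f : Lp ℂ 2 μ) g)).trans (.of_forall fun x => ?_))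
        simp [mul_add]
      map_smul' := by
        intro c f
        rw [RingHom.id_apply, ← MemLp.toLp_const_smul]
        refine (MemLp.toLp_eq_toLp_iff _ _).2
          ((h.mul_comp_congr (Lp.coeFn_smul c (f : Lp ℂ 2 μ))).trans (.of_forall fun x => ?_))
        simp [mul_left_comm] }

/-- The composition operator `C_φ = C_{φ,1}`. -/
def compOp (μ : Measure X) (φ : X → X) (hφ : Measure.QuasiMeasurePreserving φ μ μ) :
    Lp ℂ 2 μ →ₗ.[ℂ] Lp ℂ 2 μ :=
  weightedComp μ φ (fun _ => 1) (.of_quasi hφ measurable_const)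

/-- The Radon-Nikodym derivative `h_φ = d(μ ∘ φ⁻¹)/dμ`, with values in `[0, ∞]`. -/
def hDeriv (μ : Measure X) (φ : X → X) : X → ℝ≥0∞ :=
  (μ.map φ).rnDeriv μ

/-- The weight `h_φ⁻¹ ∘ φ`, as a complex function. -/
def recipWeight (μ : Measure X) (φ : X → X) : X → ℂ :=
  fun x => (((hDeriv μ φ (φ x))⁻¹).toReal : ℂ)

theorem measurable_recipWeight {μ : Measure X} {φ : X → X} (hφ : Measurable φ) :
    Measurable (recipWeight μ φ) :=
  Complex.measurable_ofReal.comp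
    (((Measure.measurable_rnDeriv (μ.map φ) μ).comp hφ).inv.ennreal_toReal)

/-- The conditional expectation `E_φ(f)` of `f ∈ L²(μ)` with respect to the σ-algebra
`φ⁻¹(𝒜)` and the measure `μ`. -/
def condExpComp (μ : Measure X) {φ : X → X} (hφ : Measurable φ) (f : Lp ℂ 2 μ) : X → ℂ :=
  ((condExpL2 ℂ ℂ hφ.comap_le f : Lp ℂ 2 μ) : X → ℂ)

/-- `g` is a version of `E_φ(f) ∘ φ⁻¹`: it is measurable, it vanishes a.e. on `{h_φ = 0}`, and
`E_φ(f) = g ∘ φ` a.e. -/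
structure IsCondExpCompInv (μ : Measure X) {φ : X → X} (hφ : Measurable φ) (f : Lp ℂ 2 μ)
    (g : X → ℂ) : Prop where
  measurable : Measurable g
  ae_zero : ∀ᵐ x ∂μ, hDeriv μ φ x = 0 → g x = 0
  ae_comp : ∀ᵐ x ∂μ, condExpComp μ hφ f x = g (φ x)

theorem map_eq_withDensity {μ : Measure X} [SigmaFinite μ] {φ : X → X}
    (hφ : Measure.QuasiMeasurePreserving φ μ μ) :
    μ.withDensity (hDeriv μ φ) = μ.map φ :=
  Measure.withDensity_rnDeriv_eq _ _ hφ.absolutelyContinuous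

theorem exists_isCondExpCompInv (μ : Measure X) [SigmaFinite μ] {φ : X → X}
    (hφ : Measure.QuasiMeasurePreserving φ μ μ) (f : Lp ℂ 2 μ) :
    ∃ g : X → ℂ, IsCondExpCompInv μ hφ.measurable f g := by
  have hm := aestronglyMeasurable_condExpL2 (𝕜 := ℂ) (μ := μ) hφ.measurable.comap_le f
  obtain ⟨g0, hg0, hgm⟩ := hm.stronglyMeasurable_mk.measurable.exists_eq_measurable_comp
  have hh : Measurable (hDeriv μ φ) := Measure.measurable_rnDeriv _ _
  have hs : MeasurableSet {x | hDeriv μ φ x ≠ 0} := (hh (measurableSet_singleton 0)).compl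
  refine ⟨{x | hDeriv μ φ x ≠ 0}.indicator g0, hg0.indicator hs, ?_, ?_⟩
  · exact .of_forall fun x hx => by simp [hx]
  · have h0 : ∀ᵐ x ∂μ, hDeriv μ φ (φ x) ≠ 0 := by
      refine ae_of_ae_map (p := fun y => hDeriv μ φ y ≠ 0) hφ.measurable.aemeasurable ?_
      rw [← map_eq_withDensity hφ, ae_withDensity_iff hh]
      exact .of_forall fun x hx => hx
    filter_upwards [h0, hm.ae_eq_mk] with x hx hx'
    rw [Set.indicator_of_mem (show φ x ∈ {x | hDeriv μ φ x ≠ 0} from hx)]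
    exact hx'.trans (congrFun hgm x)

theorem IsCondExpCompInv.ae_eq {μ : Measure X} [SigmaFinite μ] {φ : X → X}
    (hφ : Measure.QuasiMeasurePreserving φ μ μ) {f : Lp ℂ 2 μ} {g g' : X → ℂ}
    (hg : IsCondExpCompInv μ hφ.measurable f g) (hg' : IsCondExpCompInv μ hφ.measurable f g') :
    g =ᵐ[μ] g' := by
  have hh : Measurable (hDeriv μ φ) := Measure.measurable_rnDeriv _ _
  have h1 : ∀ᵐ y ∂(μ.map φ), g y = g' y := by
    rw [ae_map_iff hφ.measurable.aemeasurable (measurableSet_eq_fun hg.measurable hg'.measurable)]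
    filter_upwards [hg.ae_comp, hg'.ae_comp] with x h1 h2
    exact h1.symm.trans h2
  rw [← map_eq_withDensity hφ, ae_withDensity_iff hh] at h1
  filter_upwards [h1, hg.ae_zero, hg'.ae_zero] with x h1 h2 h3
  by_cases hx : hDeriv μ φ x = 0
  · rw [h2 hx, h3 hx]
  · exact h1 hx

/-- The function `E_φ(f) ∘ φ⁻¹`, which is unique up to `μ`-null sets. -/
def condExpCompInv (μ : Measure X) [SigmaFinite μ] {φ : X → X}
    (hφ : Measure.QuasiMeasurePreserving φ μ μ) (f : Lp ℂ 2 μ) : X → ℂ :=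
  (exists_isCondExpCompInv μ hφ f).choose

theorem isCondExpCompInv_condExpCompInv (μ : Measure X) [SigmaFinite μ] {φ : X → X}
    (hφ : Measure.QuasiMeasurePreserving φ μ μ) (f : Lp ℂ 2 μ) :
    IsCondExpCompInv μ hφ.measurable f (condExpCompInv μ hφ f) :=
  (exists_isCondExpCompInv μ hφ f).choose_spec

end Composition

end

end Recip

/-! Write $h=\mathsf h_\phi$. Everything rests on $\mu\circ\phi^{-1}=h\mu$: a statement about
$\phi(x)$ holds for a.e. $x$ iff it holds a.e. on $\{h\ne0\}$, and $\int G\circ\phi\,d\mu=\int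
G\,h\,d\mu$. Density of $\mathcal D(C_\phi)$ forces $h<\infty$ a.e. (`ae_hDeriv_lt_top`), so $h\mu$
is σ-finite and truncations are available (`exists_exhaustion`).

Let $M$ be the subspace of $\phi^{-1}(\mathscr A)$-measurable functions in $L^2(\mu)$. Then
$\mathcal R(C_\phi)^\perp=M^\perp$, while $\mathcal N(C_\phi)^\perp$ consists of the functions
vanishing on $\{h=0\}$. Since $\mathsf E_\phi$ is the projection onto $M$, a pair $(f,g)$ is in the
graph of $C_\phi^\dagger$ iff $g\circ\phi=\mathsf E_\phi(f)$ and $g=0$ on $\{h=0\}$, which is (i).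

For (ii), $\mathcal N(C_\phi^*)^\perp=M$, $\mathcal R(C_\phi^*)^\perp=\mathcal N(C_\phi)$, and
$C_\phi^*(v\circ\phi)=hv$ (`adjoint_compOp_ae_eq`). So $(f,g)$ is in the graph of
$(C_\phi^*)^\dagger$ iff $g=v\circ\phi$ with $f=hv$ on $\{h\ne0\}$, that is, $g=(f/h)\circ\phi$. -/

namespace Recip

/-! ### Kernels, ranges and adjoints of partially defined operators -/

section Hilbert

variable {H : Type*} [NormedAddCommGroup H] [InnerProductSpace ℂ H]

/-- Because $\mathcal N(T)\subseteq\mathcal D(T)$, projecting a vector of $\mathcal D(T)$ onto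
$\mathcal N(T)$ leaves both components in $\mathcal D(T)$. -/
theorem hasReciprocal_of_hasOrthogonalProjection {T : H →ₗ.[ℂ] H}
    [(ker T).HasOrthogonalProjection] : HasReciprocal T := by
  have hle : ker T ≤ T.domain := by
    intro x hx
    obtain ⟨u, rfl, -⟩ := (mem_ker T).1 hx
    exact u.2
  refine le_antisymm (fun f hf => ?_) (sup_le hle inf_le_left)
  have h1 : (ker T).starProjection f ∈ ker T := Submodule.starProjection_apply_mem _ _
  exact Submodule.mem_sup.2 ⟨_, h1, f - (ker T).starProjection f,
    ⟨sub_mem hf (hle h1), Submodule.sub_starProjection_mem_orthogonal f⟩, by abel⟩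

theorem ker_adjoint [CompleteSpace H] {T : H →ₗ.[ℂ] H} (hT : Dense (T.domain : Set H)) :
    ker T.adjoint = (ran T)ᗮ := by
  ext x
  rw [mem_ker, Submodule.mem_orthogonal']
  constructor
  · rintro ⟨u, rfl, hu⟩ _ ⟨v, rfl⟩
    have := LinearPMap.adjoint_isFormalAdjoint hT u v
    rw [hu, inner_zero_left] at this
    exact this.symm
  · intro hx
    have h0 : ∀ v : T.domain, inner ℂ (0 : H) (v : H) = inner ℂ x (T v) := fun v => by
      rw [inner_zero_left]
      exact (hx _ ⟨v, rfl⟩).symm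
    refine ⟨⟨x, LinearPMap.mem_adjoint_domain_of_exists x ⟨0, h0⟩⟩, rfl, ?_⟩
    exact LinearPMap.adjoint_apply_eq hT _ h0

theorem ker_le_orthogonal_ran_adjoint [CompleteSpace H] {T : H →ₗ.[ℂ] H}
    (hT : Dense (T.domain : Set H)) : ker T ≤ (ran T.adjoint)ᗮ := by
  intro x hx
  obtain ⟨u, rfl, hu⟩ := (mem_ker T).1 hx
  refine (Submodule.mem_orthogonal _ _).2 ?_
  rintro _ ⟨v, rfl⟩
  have := LinearPMap.adjoint_isFormalAdjoint hT v u
  rwa [hu, inner_zero_right] at this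

end Hilbert

/-! ### Truncation in $L^2(\mu)$ -/

section Indicator

variable {X : Type*} [MeasurableSpace X] {μ : Measure X}

/-- Multiplication of a function in `L²(μ)` by the indicator of a measurable set. -/
noncomputable def indicatorLp {s : Set X} (hs : MeasurableSet s) (f : Lp ℂ 2 μ) : Lp ℂ 2 μ :=
  ((Lp.memLp f).indicator hs).toLp _

theorem coeFn_indicatorLp {s : Set X} (hs : MeasurableSet s) (f : Lp ℂ 2 μ) :
    indicatorLp hs f =ᵐ[μ] s.indicator f :=
  MemLp.coeFn_toLp _

/-- $\langle 1_sf,f\rangle=\|1_sf\|^2$. This localizes orthogonality: if $f$ is orthogonal to a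
subspace containing $1_sf$, then $f$ vanishes on $s$. -/
theorem ae_eq_zero_of_inner_indicatorLp {s : Set X} (hs : MeasurableSet s) {f : Lp ℂ 2 μ}
    (h : inner ℂ (indicatorLp hs f) f = 0) : ∀ᵐ x ∂μ, x ∈ s → f x = 0 := by
  have h0 : indicatorLp hs f = 0 := by
    refine (inner_self_eq_zero (𝕜 := ℂ)).1 (Eq.trans ?_ h)
    rw [L2.inner_def, L2.inner_def]
    refine integral_congr_ae ?_
    filter_upwards [coeFn_indicatorLp hs f] with x hx
    rw [hx]
    by_cases hxs : x ∈ s <;> simp [hxs]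
  filter_upwards [coeFn_indicatorLp hs f, (Lp.eq_zero_iff_ae_eq_zero).1 h0] with x h1 h2 hxs
  rw [h2, Set.indicator_of_mem hxs] at h1
  exact h1.symm

theorem memLp_indicator_of_bound {s : Set X} (hs : MeasurableSet s) (hμs : μ s < ∞) {v : X → ℂ}
    (hv : Measurable v) {c : ℝ} (hc : ∀ x ∈ s, ‖v x‖ ≤ c) : MemLp (s.indicator v) 2 μ := by
  rw [memLp_indicator_iff_restrict hs]
  have : IsFiniteMeasure (μ.restrict s) := ⟨by simpa using hμs⟩
  exact MemLp.of_bound hv.aestronglyMeasurable c ((ae_restrict_iff' hs).2 (.of_forall hc))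

end Indicator

section Composition

variable {X : Type*} [MeasurableSpace X] {μ : Measure X} {φ : X → X}

theorem measurable_hDeriv : Measurable (hDeriv μ φ) :=
  Measure.measurable_rnDeriv _ _

variable (μ φ) in
theorem measurableSet_hDeriv_eq_zero : MeasurableSet {x | hDeriv μ φ x = 0} :=
  measurable_hDeriv (measurableSet_singleton 0)

variable (μ φ) in
theorem measurableSet_hDeriv_ne_zero : MeasurableSet {x | hDeriv μ φ x ≠ 0} :=
  (measurableSet_hDeriv_eq_zero μ φ).compl

theorem measurable_coeFn (f : Lp ℂ 2 μ) : Measurable f :=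
  (Lp.stronglyMeasurable f).measurable

theorem coeFn_weightedComp {w : X → ℂ} (h : WellDefined μ φ w)
    (q : (weightedComp μ φ w h).domain) :
    weightedComp μ φ w h q =ᵐ[μ] fun x => w x * (q : Lp ℂ 2 μ) (φ x) :=
  MemLp.coeFn_toLp q.2

theorem mem_domain_weightedComp {w : X → ℂ} (h : WellDefined μ φ w) {f : Lp ℂ 2 μ} :
    f ∈ (weightedComp μ φ w h).domain ↔ MemLp (fun x => w x * f (φ x)) 2 μ :=
  Iff.rfl

theorem coeFn_compOp (hφ : Measure.QuasiMeasurePreserving φ μ μ) (q : (compOp μ φ hφ).domain) :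
    compOp μ φ hφ q =ᵐ[μ] fun x => (q : Lp ℂ 2 μ) (φ x) :=
  (coeFn_weightedComp _ q).trans (.of_forall fun _ => one_mul _)

theorem mem_domain_compOp (hφ : Measure.QuasiMeasurePreserving φ μ μ) {f : Lp ℂ 2 μ} :
    f ∈ (compOp μ φ hφ).domain ↔ MemLp (fun x => f (φ x)) 2 μ := by
  rw [compOp, mem_domain_weightedComp]
  simp only [one_mul]

theorem comp_congr_ae (hφ : Measure.QuasiMeasurePreserving φ μ μ) {f g : X → ℂ}
    (h : f =ᵐ[μ] g) : (fun x => f (φ x)) =ᵐ[μ] fun x => g (φ x) :=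
  hφ.ae_eq_comp h

/-! ### Transfer along $\phi$ and finiteness of $h$ -/

section SigmaFinite

variable [SigmaFinite μ] (hφ : Measure.QuasiMeasurePreserving φ μ μ)
include hφ

theorem ae_comp_of_ae {p : X → Prop} (h : ∀ᵐ y ∂μ, hDeriv μ φ y ≠ 0 → p y) :
    ∀ᵐ x ∂μ, p (φ x) := by
  refine ae_of_ae_map hφ.measurable.aemeasurable ?_
  rwa [← map_eq_withDensity hφ, ae_withDensity_iff measurable_hDeriv]

theorem ae_of_ae_comp {p : X → Prop} (hp : MeasurableSet {y | p y})
    (h : ∀ᵐ x ∂μ, p (φ x)) : ∀ᵐ y ∂μ, hDeriv μ φ y ≠ 0 → p y := by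
  rwa [← ae_map_iff hφ.measurable.aemeasurable hp, ← map_eq_withDensity hφ,
    ae_withDensity_iff measurable_hDeriv] at h

theorem ae_hDeriv_comp_ne_zero : ∀ᵐ x ∂μ, hDeriv μ φ (φ x) ≠ 0 :=
  ae_comp_of_ae hφ (p := fun y => hDeriv μ φ y ≠ 0) (.of_forall fun _ h => h)

/-- For $f\in\mathcal D(C_\phi)$ one has $\int h|f|^2\,d\mu<\infty$, so $f=0$ a.e. on
$\{h=\infty\}$. A dense subspace cannot consist of functions vanishing on a set of positive measure.
-/
theorem ae_hDeriv_lt_top (hdense : Dense ((compOp μ φ hφ).domain : Set (Lp ℂ 2 μ))) :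
    ∀ᵐ x ∂μ, hDeriv μ φ x < ∞ := by
  have hzero : ∀ f ∈ (compOp μ φ hφ).domain, ∀ᵐ x ∂μ, hDeriv μ φ x = ∞ → f x = 0 := by
    intro f hf
    have h1 := (mem_domain_compOp hφ).1 hf
    have hm : Measurable fun y => ‖f y‖ₑ ^ (2 : ℝ) := (measurable_coeFn f).enorm.pow_const _
    have h2 : ∫⁻ y, hDeriv μ φ y * ‖f y‖ₑ ^ (2 : ℝ) ∂μ < ∞ := by
      have := lintegral_rpow_enorm_lt_top_of_eLpNorm_lt_top two_ne_zero ENNReal.ofNat_ne_top h1.2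
      rw [ENNReal.toReal_ofNat] at this
      change ∫⁻ y, (hDeriv μ φ * fun y => ‖f y‖ₑ ^ (2 : ℝ)) y ∂μ < ∞
      rwa [← lintegral_withDensity_eq_lintegral_mul _ measurable_hDeriv hm,
        map_eq_withDensity hφ, lintegral_map hm hφ.measurable]
    filter_upwards [ae_lt_top (measurable_hDeriv.mul hm) h2.ne] with x hx htop
    by_contra hfx
    rw [Pi.mul_apply, htop, ENNReal.top_mul (by simpa using hfx)] at hx
    exact lt_irrefl _ hx
  have hs : MeasurableSet {x | hDeriv μ φ x = ∞} := measurable_hDeriv (measurableSet_singleton _)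
  have hn : ∀ n, μ ({x | hDeriv μ φ x = ∞} ∩ spanningSets μ n) = 0 := by
    intro n
    have hm := hs.inter (measurableSet_spanningSets μ n)
    have hfin : μ ({x | hDeriv μ φ x = ∞} ∩ spanningSets μ n) ≠ ∞ :=
      ((measure_mono Set.inter_subset_right).trans_lt (measure_spanningSets_lt_top μ n)).ne
    -- The finite-measure pieces of $\{h=\infty\}$ have indicators in $L^2(\mu)$, and these are
    -- orthogonal to the dense domain.
    have h0 : indicatorConstLp 2 hm hfin (1 : ℂ) = 0 := by
      refine hdense.eq_zero_of_inner_left ℂ fun f hf => ?_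
      rw [L2.inner_indicatorConstLp_one]
      refine setIntegral_eq_zero_of_ae_eq_zero ?_
      filter_upwards [hzero f hf] with x hx hxs
      exact hx hxs.1
    have h1 := (indicatorConstLp_coeFn (p := 2) (hs := hm) (hμs := hfin) (c := (1 : ℂ))).symm.trans
      ((Lp.eq_zero_iff_ae_eq_zero).1 h0)
    refine measure_mono_null (fun x hx => ?_) (ae_iff.1 h1)
    change Set.indicator _ (fun _ => (1 : ℂ)) x ≠ 0
    rw [Set.indicator_of_mem hx]
    exact one_ne_zero
  have : μ {x | hDeriv μ φ x = ∞} = 0 := by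
    rw [← Set.inter_univ {x | _}, ← iUnion_spanningSets μ, Set.inter_iUnion]
    exact measure_iUnion_null hn
  rw [ae_iff]
  simpa using this

/-- On each `B n` a function bounded by `v` is square-integrable, and so is its composition with
$\phi$ on `φ ⁻¹' B n`. Finiteness of $\mu(\phi^{-1}(B_n))$ is where $h<\infty$ enters: it makes
`μ.map φ` σ-finite. -/
theorem exists_exhaustion (hh : ∀ᵐ x ∂μ, hDeriv μ φ x < ∞) {v : X → ℝ} (hv : Measurable v) :
    ∃ B : ℕ → Set X, (∀ n, MeasurableSet (B n)) ∧ (∀ n, μ (B n) < ∞) ∧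
      (∀ n, μ (φ ⁻¹' B n) < ∞) ∧ (∀ n, ∀ x ∈ B n, v x ≤ n) ∧ ∀ x, ∃ n, x ∈ B n := by
  have : SigmaFinite (μ.map φ) := by
    rw [← map_eq_withDensity hφ]
    exact SigmaFinite.withDensity_of_ne_top (hh.mono fun x hx => hx.ne)
  refine ⟨fun n => spanningSets μ n ∩ spanningSets (μ.map φ) n ∩ {x | v x ≤ n},
    fun n => ((measurableSet_spanningSets _ _).inter (measurableSet_spanningSets _ _)).inter
      (measurableSet_le hv measurable_const), fun n => ?_, fun n => ?_, fun n x hx => hx.2,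
    fun x => ?_⟩
  · exact (measure_mono fun x hx => hx.1.1).trans_lt (measure_spanningSets_lt_top μ n)
  · refine (measure_mono fun x hx => ?_).trans_lt
      ((Measure.map_apply hφ.measurable (measurableSet_spanningSets (μ.map φ) n)).symm.trans_lt
        (measure_spanningSets_lt_top (μ.map φ) n))
    exact hx.1.2
  · obtain ⟨n, hn⟩ := exists_nat_ge (v x)
    refine ⟨max n (max (spanningSetsIndex μ x) (spanningSetsIndex (μ.map φ) x)), ⟨?_, ?_⟩, ?_⟩
    · exact monotone_spanningSets _ ((le_max_left _ _).trans (le_max_right _ _))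
        (mem_spanningSetsIndex μ x)
    · exact monotone_spanningSets _ ((le_max_right _ _).trans (le_max_right _ _))
        (mem_spanningSetsIndex (μ.map φ) x)
    · exact hn.trans (Nat.cast_le.2 (le_max_left _ _))

/-! ### Range, kernel and reciprocal of $C_\phi$ -/

/-- The range of `C_φ` is dense in the space of `φ⁻¹(𝒜)`-measurable functions. -/
theorem eq_zero_of_mem_orthogonal_ran_compOp (hh : ∀ᵐ x ∂μ, hDeriv μ φ x < ∞) {u : Lp ℂ 2 μ}
    {v : X → ℂ} (hv : Measurable v) (huv : u =ᵐ[μ] fun x => v (φ x))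
    (hu : u ∈ (ran (compOp μ φ hφ))ᗮ) : u = 0 := by
  obtain ⟨B, hB, hμB, hμφB, hvB, hcov⟩ := exists_exhaustion hφ hh hv.norm
  have hn : ∀ n, ∀ᵐ x ∂μ, φ x ∈ B n → u x = 0 := by
    intro n
    have hq := memLp_indicator_of_bound (hB n) (hμB n) hv (hvB n)
    have hqc := comp_congr_ae hφ hq.coeFn_toLp
    have hCq : MemLp (fun x => (hq.toLp _ : Lp ℂ 2 μ) (φ x)) 2 μ := by
      rw [memLp_congr_ae hqc]
      exact memLp_indicator_of_bound (hφ.measurable (hB n)) (hμφB n) (hv.comp hφ.measurable)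
        fun x hx => hvB n (φ x) hx
    let q : (compOp μ φ hφ).domain := ⟨hq.toLp _, (mem_domain_compOp hφ).2 hCq⟩
    -- The truncation $1_{\phi^{-1}(B_n)}u=C_\phi(1_{B_n}v)$ lies in the range, to which $u$ is
    -- orthogonal.
    have key : indicatorLp (hφ.measurable (hB n)) u = compOp μ φ hφ q := by
      refine Lp.ext (((coeFn_indicatorLp _ u).trans ?_).trans
        (hqc.symm.trans (coeFn_compOp hφ q).symm))
      filter_upwards [huv] with x hx
      by_cases hxB : φ x ∈ B n <;> simp [hxB, hx]
    refine ae_eq_zero_of_inner_indicatorLp (hφ.measurable (hB n)) ?_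
    rw [key]
    exact (Submodule.mem_orthogonal _ _).1 hu _ ⟨q, rfl⟩
  refine (Lp.eq_zero_iff_ae_eq_zero).2 ?_
  filter_upwards [ae_all_iff.2 hn] with x hx
  obtain ⟨n, hxn⟩ := hcov (φ x)
  exact hx n hxn

omit [SigmaFinite μ] hφ in
-- Doob–Dynkin factorization: $\phi^{-1}(\mathscr A)$-measurable functions are those of the form
-- $v\circ\phi$.
theorem mem_lpMeas_comap_iff {u : Lp ℂ 2 μ} :
    u ∈ lpMeas ℂ ℂ (MeasurableSpace.comap φ inferInstance) 2 μ ↔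
      ∃ v : X → ℂ, Measurable v ∧ u =ᵐ[μ] fun x => v (φ x) := by
  rw [mem_lpMeas_iff_aestronglyMeasurable]
  constructor
  · intro hu
    obtain ⟨v, hv, hvm⟩ := hu.stronglyMeasurable_mk.measurable.exists_eq_measurable_comp
    exact ⟨v, hv, hu.ae_eq_mk.trans (.of_forall fun x => congrFun hvm x)⟩
  · rintro ⟨v, hv, huv⟩
    exact ⟨fun x => v (φ x), (hv.comp (comap_measurable φ)).stronglyMeasurable, huv⟩

omit [SigmaFinite μ] in
theorem ran_compOp_le : ran (compOp μ φ hφ) ≤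
    lpMeas ℂ ℂ (MeasurableSpace.comap φ inferInstance) 2 μ := by
  rintro _ ⟨q, rfl⟩
  exact mem_lpMeas_comap_iff.2 ⟨q, measurable_coeFn _, coeFn_compOp hφ q⟩

theorem orthogonal_ran_compOp (hh : ∀ᵐ x ∂μ, hDeriv μ φ x < ∞) :
    (ran (compOp μ φ hφ))ᗮ = (lpMeas ℂ ℂ (MeasurableSpace.comap φ inferInstance) 2 μ)ᗮ := by
  have : Fact (MeasurableSpace.comap φ inferInstance ≤ ‹MeasurableSpace X›) :=
    ⟨hφ.measurable.comap_le⟩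
  set M := lpMeas ℂ ℂ (MeasurableSpace.comap φ inferInstance) 2 μ
  refine le_antisymm (fun u hu => ?_) (Submodule.orthogonal_le (ran_compOp_le hφ))
  have h1 : M.starProjection u ∈ M := Submodule.starProjection_apply_mem _ _
  have h2 : u - M.starProjection u ∈ Mᗮ := Submodule.sub_starProjection_mem_orthogonal u
  -- The $M$-component of $u$ is orthogonal to the range and factors through $\phi$, so it is zero.
  have h3 : M.starProjection u ∈ (ran (compOp μ φ hφ))ᗮ := by
    have := sub_mem hu (Submodule.orthogonal_le (ran_compOp_le hφ) h2)
    simpa using this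
  obtain ⟨v, hv, huv⟩ := mem_lpMeas_comap_iff.1 h1
  rwa [eq_zero_of_mem_orthogonal_ran_compOp hφ hh hv huv h3, sub_zero] at h2

theorem mem_ker_compOp {f : Lp ℂ 2 μ} :
    f ∈ ker (compOp μ φ hφ) ↔ ∀ᵐ x ∂μ, hDeriv μ φ x ≠ 0 → f x = 0 := by
  rw [mem_ker]
  constructor
  · rintro ⟨u, rfl, hu⟩
    refine ae_of_ae_comp hφ (measurable_coeFn (u : Lp ℂ 2 μ) (measurableSet_singleton 0)) ?_
    filter_upwards [coeFn_compOp hφ u, (Lp.eq_zero_iff_ae_eq_zero).1 hu] with x h1 h2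
    exact h1.symm.trans h2
  · intro h
    have h0 : (fun x => f (φ x)) =ᵐ[μ] fun _ => 0 := ae_comp_of_ae hφ (p := fun y => f y = 0) h
    refine ⟨⟨f, (mem_domain_compOp hφ).2 ((memLp_congr_ae h0).2 MemLp.zero')⟩, rfl, ?_⟩
    exact (Lp.eq_zero_iff_ae_eq_zero).2 ((coeFn_compOp hφ _).trans h0)

theorem indicatorLp_mem_ker_compOp (f : Lp ℂ 2 μ) :
    indicatorLp (measurableSet_hDeriv_eq_zero μ φ) f ∈ ker (compOp μ φ hφ) := by
  refine (mem_ker_compOp hφ).2 ?_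
  filter_upwards [coeFn_indicatorLp (measurableSet_hDeriv_eq_zero μ φ) f] with x hx h0
  rw [hx]
  exact Set.indicator_of_notMem (s := {x | hDeriv μ φ x = 0}) h0 _

theorem mem_orthogonal_ker_compOp {f : Lp ℂ 2 μ} :
    f ∈ (ker (compOp μ φ hφ))ᗮ ↔ ∀ᵐ x ∂μ, hDeriv μ φ x = 0 → f x = 0 := by
  constructor
  · intro hf
    exact ae_eq_zero_of_inner_indicatorLp (measurableSet_hDeriv_eq_zero μ φ)
      ((Submodule.mem_orthogonal _ _).1 hf _ (indicatorLp_mem_ker_compOp hφ f))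
  · intro hf
    refine (Submodule.mem_orthogonal _ _).2 fun g hg => ?_
    rw [L2.inner_def]
    refine integral_eq_zero_of_ae ?_
    filter_upwards [hf, (mem_ker_compOp hφ).1 hg] with x h1 h2
    by_cases hx : hDeriv μ φ x = 0
    · simp [h1 hx]
    · simp [h2 hx]

theorem hasReciprocal_compOp : HasReciprocal (compOp μ φ hφ) := by
  -- The kernel is closed: if $f\in\mathcal N(C_\phi)^{\perp\perp}$, then $1_{\{h\ne0\}}f\in\mathcal
  -- N(C_\phi)^\perp$ is orthogonal to $f$, hence zero.
  have hcl : ker (compOp μ φ hφ) = (ker (compOp μ φ hφ))ᗮᗮ := by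
    refine le_antisymm (Submodule.le_orthogonal_orthogonal _) fun f hf => ?_
    refine (mem_ker_compOp hφ).2 (ae_eq_zero_of_inner_indicatorLp (measurableSet_hDeriv_ne_zero μ φ) ?_)
    refine (Submodule.mem_orthogonal _ _).1 hf _ ((mem_orthogonal_ker_compOp hφ).2 ?_)
    filter_upwards [coeFn_indicatorLp (measurableSet_hDeriv_ne_zero μ φ) f] with x hx h0
    rw [hx, Set.indicator_of_notMem (by simpa using h0)]
  have : (ker (compOp μ φ hφ)).HasOrthogonalProjection := by
    rw [hcl]
    infer_instance
  exact hasReciprocal_of_hasOrthogonalProjection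

theorem sub_mem_orthogonal_ran_compOp_iff (hh : ∀ᵐ x ∂μ, hDeriv μ φ x < ∞) {f : Lp ℂ 2 μ}
    (u : (compOp μ φ hφ).domain) : f - compOp μ φ hφ u ∈ (ran (compOp μ φ hφ))ᗮ ↔
      condExpComp μ hφ.measurable f =ᵐ[μ] fun x => (u : Lp ℂ 2 μ) (φ x) := by
  have : Fact (MeasurableSpace.comap φ inferInstance ≤ ‹MeasurableSpace X›) :=
    ⟨hφ.measurable.comap_le⟩
  -- `condExpL2` is by definition the orthogonal projection onto $M$.
  have hE : condExpComp μ hφ.measurable f =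
    ((lpMeas ℂ ℂ (MeasurableSpace.comap φ inferInstance) 2 μ).starProjection f : X → ℂ) := rfl
  rw [orthogonal_ran_compOp hφ hh, hE]
  set M := lpMeas ℂ ℂ (MeasurableSpace.comap φ inferInstance) 2 μ
  trans M.starProjection f = compOp μ φ hφ u
  · constructor
    · intro h
      exact Submodule.eq_starProjection_of_mem_orthogonal (ran_compOp_le hφ ⟨u, rfl⟩) h
    · intro h
      rw [← h]
      exact Submodule.sub_starProjection_mem_orthogonal f
  · constructor
    · intro h
      rw [h]
      exact coeFn_compOp hφ u
    · intro h
      exact Lp.ext (h.trans (coeFn_compOp hφ u).symm)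

theorem mem_graph_reciprocal_compOp_iff (hh : ∀ᵐ x ∂μ, hDeriv μ φ x < ∞) (f g : Lp ℂ 2 μ) :
    (f, g) ∈ (reciprocal (compOp μ φ hφ)).graph ↔ g =ᵐ[μ] condExpCompInv μ hφ f := by
  have hk := isCondExpCompInv_condExpCompInv μ hφ f
  rw [mem_graph_reciprocal]
  constructor
  · rintro ⟨u, rfl, h1, h2⟩
    exact IsCondExpCompInv.ae_eq hφ ⟨measurable_coeFn _, (mem_orthogonal_ker_compOp hφ).1 h1,
      (sub_mem_orthogonal_ran_compOp_iff hφ hh u).1 h2⟩ hk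
  · intro hg
    have hE : condExpComp μ hφ.measurable f =ᵐ[μ] fun x => g (φ x) :=
      Filter.EventuallyEq.trans hk.ae_comp (comp_congr_ae hφ hg.symm)
    -- Membership in the domain is automatic, since $g\circ\phi=\mathsf E_\phi(f)$ is already in
    -- $L^2(\mu)$.
    have hd : g ∈ (compOp μ φ hφ).domain :=
      (mem_domain_compOp hφ).2 ((memLp_congr_ae hE).1 (Lp.memLp _))
    refine ⟨⟨g, hd⟩, rfl, (mem_orthogonal_ker_compOp hφ).2 ?_,
      (sub_mem_orthogonal_ran_compOp_iff hφ hh _).2 hE⟩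
    filter_upwards [hg, hk.ae_zero] with x h1 h2 h3
    rw [h1, h2 h3]

end SigmaFinite

end Composition

/-! ### The adjoint of $C_\phi$ and its reciprocal -/

section Composition

variable {X : Type*} [MeasurableSpace X] {μ : Measure X} {φ : X → X}

theorem recipWeight_of_ne_zero_of_lt_top {x : X} (h0 : hDeriv μ φ (φ x) ≠ 0)
    (h1 : hDeriv μ φ (φ x) < ∞) :
    recipWeight μ φ x * ((hDeriv μ φ (φ x)).toReal : ℂ) = 1 := by
  rw [recipWeight, ENNReal.toReal_inv, ← Complex.ofReal_mul,
    inv_mul_cancel₀ (ENNReal.toReal_ne_zero.2 ⟨h0, h1.ne⟩), Complex.ofReal_one]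

variable [SigmaFinite μ] (hφ : Measure.QuasiMeasurePreserving φ μ μ)
include hφ

variable (μ φ) in
/-- The operator `C_{φ,w}` with the weight `w = h_φ⁻¹ ∘ φ`. -/
noncomputable abbrev recipComp : Lp ℂ 2 μ →ₗ.[ℂ] Lp ℂ 2 μ :=
  weightedComp μ φ (recipWeight μ φ) (.of_quasi hφ (measurable_recipWeight hφ.measurable))

/-- Change of variables: the density $h$ cancels $1/h$ where $h\ne0$ and kills the integrand where
$h=0$. This identifies $C_\phi^*$ on the range of `recipComp`. -/
theorem inner_recipComp_compOp (hh : ∀ᵐ x ∂μ, hDeriv μ φ x < ∞) (f : (recipComp μ φ hφ).domain)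
    (q : (compOp μ φ hφ).domain) :
    inner ℂ (recipComp μ φ hφ f) (compOp μ φ hφ q) =
      inner ℂ (indicatorLp (measurableSet_hDeriv_ne_zero μ φ) (f : Lp ℂ 2 μ)) (q : Lp ℂ 2 μ) := by
  rw [L2.inner_def, L2.inner_def]
  let G : X → ℂ := fun y =>
    inner ℂ ((((hDeriv μ φ y)⁻¹).toReal : ℂ) * (f : Lp ℂ 2 μ) y) ((q : Lp ℂ 2 μ) y)
  have hG : Measurable G := by
    have h1 := measurable_coeFn (f : Lp ℂ 2 μ)
    have h2 := measurable_coeFn (q : Lp ℂ 2 μ)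
    have h3 := (measurable_hDeriv (μ := μ) (φ := φ)).inv.ennreal_toReal
    exact Measurable.inner ((Complex.measurable_ofReal.comp h3).mul h1) h2
  trans ∫ x, G (φ x) ∂μ
  · refine integral_congr_ae ?_
    filter_upwards [coeFn_weightedComp _ f, coeFn_compOp hφ q] with x h1 h2
    rw [h1, h2]
    rfl
  rw [← integral_map hφ.measurable.aemeasurable hG.aestronglyMeasurable, ← map_eq_withDensity hφ,
    integral_withDensity_eq_integral_toReal_smul measurable_hDeriv hh]
  refine integral_congr_ae ?_
  filter_upwards [coeFn_indicatorLp (measurableSet_hDeriv_ne_zero μ φ) (f : Lp ℂ 2 μ), hh]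
    with x h1 h2
  rw [h1]
  by_cases h0 : hDeriv μ φ x = 0
  · simp [h0]
  · rw [Set.indicator_of_mem h0]
    have : (hDeriv μ φ x).toReal ≠ 0 := ENNReal.toReal_ne_zero.2 ⟨h0, h2.ne⟩
    have h3 : ((hDeriv μ φ x).toReal : ℂ) ≠ 0 := Complex.ofReal_ne_zero.2 this
    simp only [G, RCLike.inner_apply, map_mul, ENNReal.toReal_inv, Complex.conj_ofReal,
      Complex.real_smul]
    rw [Complex.ofReal_inv]
    field_simp

variable (hdense : Dense ((compOp μ φ hφ).domain : Set (Lp ℂ 2 μ)))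
include hdense

theorem exists_adjoint_compOp_recipComp (f : (recipComp μ φ hφ).domain) :
    ∃ u : (compOp μ φ hφ).adjoint.domain, (u : Lp ℂ 2 μ) = recipComp μ φ hφ f ∧
      (compOp μ φ hφ).adjoint u =
        indicatorLp (measurableSet_hDeriv_ne_zero μ φ) (f : Lp ℂ 2 μ) := by
  have h := fun q => (inner_recipComp_compOp hφ (ae_hDeriv_lt_top hφ hdense) f q).symm
  exact ⟨⟨_, LinearPMap.mem_adjoint_domain_of_exists _ ⟨_, h⟩⟩, rfl,
    LinearPMap.adjoint_apply_eq hdense _ h⟩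

omit [SigmaFinite μ] hdense in
theorem recipComp_ae_eq (f : (recipComp μ φ hφ).domain) :
    recipComp μ φ hφ f =ᵐ[μ]
      fun x => ((((hDeriv μ φ (φ x))⁻¹).toReal : ℝ) : ℂ) * (f : Lp ℂ 2 μ) (φ x) :=
  coeFn_weightedComp _ f

omit [SigmaFinite μ] hφ hdense in
theorem measurable_inv_hDeriv_mul (f : Lp ℂ 2 μ) :
    Measurable fun y => ((((hDeriv μ φ y)⁻¹).toReal : ℝ) : ℂ) * f y :=
  (Complex.measurable_ofReal.comp measurable_hDeriv.inv.ennreal_toReal).mul (measurable_coeFn f)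

/-- No closedness of $C_\phi$ is invoked: enough truncations of $f$ are exhibited in $\mathcal
R(C_\phi^*)$ to force $f=0$ on $\{h\ne0\}$. -/
theorem orthogonal_ran_adjoint_compOp :
    (ran (compOp μ φ hφ).adjoint)ᗮ = ker (compOp μ φ hφ) := by
  have hh := ae_hDeriv_lt_top hφ hdense
  refine le_antisymm (fun f hf => ?_) (ker_le_orthogonal_ran_adjoint hdense)
  have hv := measurable_inv_hDeriv_mul (μ := μ) (φ := φ) f
  -- The bound is imposed on $|f|/h$ rather than $|f|$, because $(f/h)\circ\phi$ must be
  -- square-integrable on $\phi^{-1}(B_n)$.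
  obtain ⟨B, hB, hμB, hμφB, hvB, hcov⟩ := exists_exhaustion hφ hh hv.norm
  have hn : ∀ n, ∀ᵐ x ∂μ, x ∈ {x | hDeriv μ φ x ≠ 0} ∩ B n → f x = 0 := by
    intro n
    have hd : indicatorLp (hB n) f ∈ (recipComp μ φ hφ).domain := by
      refine (mem_domain_weightedComp _).2 ((memLp_congr_ae ?_).2
        (memLp_indicator_of_bound (hφ.measurable (hB n)) (hμφB n) (hv.comp hφ.measurable)
          fun x hx => hvB n (φ x) hx))
      filter_upwards [comp_congr_ae hφ (coeFn_indicatorLp (hB n) f)] with x hx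
      rw [hx]
      by_cases hxB : φ x ∈ B n <;> simp [hxB, recipWeight]
    obtain ⟨u, -, hu⟩ := exists_adjoint_compOp_recipComp hφ hdense ⟨_, hd⟩
    have key : indicatorLp ((measurableSet_hDeriv_ne_zero μ φ).inter (hB n)) f =
        (compOp μ φ hφ).adjoint u := by
      rw [hu]
      refine Lp.ext ((coeFn_indicatorLp _ f).trans ?_)
      filter_upwards [coeFn_indicatorLp (measurableSet_hDeriv_ne_zero μ φ) (indicatorLp (hB n) f),
        coeFn_indicatorLp (hB n) f] with x h1 h2
      rw [h1, ← Set.indicator_indicator]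
      by_cases h0 : x ∈ {x | hDeriv μ φ x ≠ 0}
      · rw [Set.indicator_of_mem h0, Set.indicator_of_mem h0, h2]
      · rw [Set.indicator_of_notMem h0, Set.indicator_of_notMem h0]
    refine ae_eq_zero_of_inner_indicatorLp ((measurableSet_hDeriv_ne_zero μ φ).inter (hB n)) ?_
    rw [key]
    exact (Submodule.mem_orthogonal _ _).1 hf _ ⟨u, rfl⟩
  refine (mem_ker_compOp hφ).2 ?_
  filter_upwards [ae_all_iff.2 hn] with x hx h0
  obtain ⟨n, hxn⟩ := hcov x
  exact hx n ⟨h0, hxn⟩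

theorem orthogonal_ker_adjoint_compOp : (ker (compOp μ φ hφ).adjoint)ᗮ =
    lpMeas ℂ ℂ (MeasurableSpace.comap φ inferInstance) 2 μ := by
  have : Fact (MeasurableSpace.comap φ inferInstance ≤ ‹MeasurableSpace X›) :=
    ⟨hφ.measurable.comap_le⟩
  rw [ker_adjoint hdense, orthogonal_ran_compOp hφ (ae_hDeriv_lt_top hφ hdense),
    Submodule.orthogonal_orthogonal]

/-- On functions of the form `v ∘ φ`, the adjoint of `C_φ` is multiplication by `h_φ`. -/
theorem adjoint_compOp_ae_eq (u : (compOp μ φ hφ).adjoint.domain) {v : X → ℂ} (hv : Measurable v)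
    (huv : (u : Lp ℂ 2 μ) =ᵐ[μ] fun x => v (φ x)) :
    (compOp μ φ hφ).adjoint u =ᵐ[μ] fun x => ((hDeriv μ φ x).toReal : ℂ) * v x := by
  have hh := ae_hDeriv_lt_top hφ hdense
  set k := (compOp μ φ hφ).adjoint u
  have hhm : Measurable fun x => (hDeriv μ φ x).toReal := measurable_hDeriv.ennreal_toReal
  have hm : Measurable fun x => ((hDeriv μ φ x).toReal : ℂ) * v x :=
    (Complex.measurable_ofReal.comp hhm).mul hv
  have hdm : Measurable fun x => k x - ((hDeriv μ φ x).toReal : ℂ) * v x :=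
    (measurable_coeFn k).sub hm
  -- Bounding the sum of the norms bounds both $hv$ and the defect $k-hv$ on `B n`.
  obtain ⟨B, hB, hμB, hμφB, hbd, hcov⟩ := exists_exhaustion hφ hh (hm.norm.add hdm.norm)
  have hn : ∀ n, ∀ᵐ x ∂μ, x ∈ B n → k x = ((hDeriv μ φ x).toReal : ℂ) * v x := by
    intro n
    have hq := memLp_indicator_of_bound (hB n) (hμB n) hdm (c := n)
      fun x hx => (le_add_of_nonneg_left (norm_nonneg _)).trans (hbd n x hx)
    have hp := memLp_indicator_of_bound (hB n) (hμB n) hm (c := n)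
      fun x hx => (le_add_of_nonneg_right (norm_nonneg _)).trans (hbd n x hx)
    have hqc := comp_congr_ae hφ hq.coeFn_toLp
    have hCq : MemLp (fun x => (hq.toLp _ : Lp ℂ 2 μ) (φ x)) 2 μ := by
      rw [memLp_congr_ae hqc]
      exact memLp_indicator_of_bound (hφ.measurable (hB n)) (hμφB n) (hdm.comp hφ.measurable)
        (c := n) fun x hx => (le_add_of_nonneg_left (norm_nonneg _)).trans (hbd n (φ x) hx)
    -- The test function is the truncated defect $1_{B_n}(k-hv)$ itself, so testing the adjoint
    -- identity against it gives $\|q\|^2=0$.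
    let q : (compOp μ φ hφ).domain := ⟨hq.toLp _, (mem_domain_compOp hφ).2 hCq⟩
    have hadj : inner ℂ k (q : Lp ℂ 2 μ) = inner ℂ (hp.toLp _) (q : Lp ℂ 2 μ) := by
      refine (LinearPMap.adjoint_isFormalAdjoint hdense u q).trans ?_
      rw [L2.inner_def, L2.inner_def]
      let G : X → ℂ := fun y => inner ℂ (v y) ((q : Lp ℂ 2 μ) y)
      have hG : Measurable G := hv.inner (measurable_coeFn (q : Lp ℂ 2 μ))
      trans ∫ x, G (φ x) ∂μ
      · refine integral_congr_ae ?_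
        filter_upwards [huv, coeFn_compOp hφ q] with x h1 h2
        rw [h1, h2]
      rw [← integral_map hφ.measurable.aemeasurable hG.aestronglyMeasurable,
        ← map_eq_withDensity hφ, integral_withDensity_eq_integral_toReal_smul measurable_hDeriv hh]
      refine integral_congr_ae ?_
      filter_upwards [hp.coeFn_toLp, hq.coeFn_toLp] with x h1 h2
      have h3 : (q : Lp ℂ 2 μ) x = (B n).indicator
        (fun x => k x - ((hDeriv μ φ x).toReal : ℂ) * v x) x := h2
      simp only [G]
      rw [h1, h3]
      by_cases hx : x ∈ B n
      · simp only [Set.indicator_of_mem hx, RCLike.inner_apply, map_mul, Complex.conj_ofReal,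
          Complex.real_smul]
        ring
      · simp [Set.indicator_of_notMem hx]
    have hq0 : (q : Lp ℂ 2 μ) = 0 := by
      refine (inner_self_eq_zero (𝕜 := ℂ)).1 (Eq.trans ?_ (sub_eq_zero.2 hadj))
      rw [← inner_sub_left, L2.inner_def, L2.inner_def]
      refine integral_congr_ae ?_
      filter_upwards [hp.coeFn_toLp, hq.coeFn_toLp, Lp.coeFn_sub k (hp.toLp _)] with x h1 h2 h4
      have h3 : (q : Lp ℂ 2 μ) x = (B n).indicator
        (fun x => k x - ((hDeriv μ φ x).toReal : ℂ) * v x) x := h2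
      rw [h3, h4, Pi.sub_apply, h1]
      by_cases hx : x ∈ B n
      · simp only [Set.indicator_of_mem hx]
      · simp [Set.indicator_of_notMem hx]
    filter_upwards [hq.coeFn_toLp, (Lp.eq_zero_iff_ae_eq_zero).1 hq0] with x h1 h2 hx
    have h3 := h1.symm.trans h2
    rw [Set.indicator_of_mem hx] at h3
    exact sub_eq_zero.1 h3
  filter_upwards [ae_all_iff.2 hn] with x hx
  obtain ⟨n, hxn⟩ := hcov x
  exact hx n hxn

omit [SigmaFinite μ] in
theorem hasReciprocal_adjoint_compOp : HasReciprocal (compOp μ φ hφ).adjoint := by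
  have : (ker (compOp μ φ hφ).adjoint).HasOrthogonalProjection := by
    rw [ker_adjoint hdense]
    infer_instance
  exact hasReciprocal_of_hasOrthogonalProjection

/-- The graphs are compared. One inclusion solves $f=hv$ for $v$ on $\{h\ne0\}$ and composes with
$\phi$; the other uses $C_\phi^*\bigl((f/h)\circ\phi\bigr)=1_{\{h\ne0\}}f$, which differs from $f$
by an element of $\mathcal N(C_\phi)$. -/
theorem reciprocal_adjoint_compOp :
    reciprocal (compOp μ φ hφ).adjoint = recipComp μ φ hφ := by
  have hh := ae_hDeriv_lt_top hφ hdense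
  refine LinearPMap.eq_of_eq_graph ?_
  ext ⟨f, g⟩
  rw [mem_graph_reciprocal, orthogonal_ker_adjoint_compOp hφ hdense,
    orthogonal_ran_adjoint_compOp hφ hdense]
  constructor
  · rintro ⟨u, rfl, h1, h2⟩
    obtain ⟨v, hv, huv⟩ := mem_lpMeas_comap_iff.1 h1
    -- Finiteness of $h$ is carried along so that it too is transferred to $\phi(x)$, where $h$ has
    -- to be inverted.
    have hf : ∀ᵐ x ∂μ, hDeriv μ φ x ≠ 0 →
        hDeriv μ φ x < ∞ ∧ f x = ((hDeriv μ φ x).toReal : ℂ) * v x := by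
      filter_upwards [(mem_ker_compOp hφ).1 h2, adjoint_compOp_ae_eq hφ hdense u hv huv,
        Lp.coeFn_sub f ((compOp μ φ hφ).adjoint u), hh] with x h3 h4 h5 h6 h0
      rw [h5, Pi.sub_apply, h4] at h3
      exact ⟨h6, sub_eq_zero.1 (h3 h0)⟩
    have hfu : (fun x => recipWeight μ φ x * f (φ x)) =ᵐ[μ] (u : Lp ℂ 2 μ) := by
      filter_upwards [ae_comp_of_ae hφ hf, ae_hDeriv_comp_ne_zero hφ, huv] with x h3 h4 h5
      rw [h5, h3.2, ← mul_assoc, recipWeight_of_ne_zero_of_lt_top h4 h3.1, one_mul]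
    have hd : f ∈ (recipComp μ φ hφ).domain :=
      (mem_domain_weightedComp _).2 ((memLp_congr_ae hfu).2 (Lp.memLp _))
    refine (LinearPMap.mem_graph_iff _).2 ⟨⟨f, hd⟩, rfl, ?_⟩
    exact Lp.ext ((coeFn_weightedComp _ _).trans hfu)
  · intro h
    obtain ⟨f, rfl, rfl⟩ := (LinearPMap.mem_graph_iff _).1 h
    obtain ⟨u, hu1, hu2⟩ := exists_adjoint_compOp_recipComp hφ hdense f
    refine ⟨u, hu1, mem_lpMeas_comap_iff.2 ⟨_, measurable_inv_hDeriv_mul (f : Lp ℂ 2 μ),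
      recipComp_ae_eq hφ f⟩, (mem_ker_compOp hφ).2 ?_⟩
    rw [hu2]
    filter_upwards [Lp.coeFn_sub (f : Lp ℂ 2 μ) (indicatorLp (measurableSet_hDeriv_ne_zero μ φ) f),
      coeFn_indicatorLp (measurableSet_hDeriv_ne_zero μ φ) (f : Lp ℂ 2 μ)] with x h1 h2 h0
    rw [h1, Pi.sub_apply, h2, Set.indicator_of_mem h0, sub_self]

end Composition

end Recip

theorem corollary6 {X : Type*} [MeasurableSpace X] (μ : Measure X) [SigmaFinite μ] (φ : X → X)
    (hφ : Measure.QuasiMeasurePreserving φ μ μ)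
    (hdense : Dense ((Recip.compOp μ φ hφ).domain : Set (Lp ℂ 2 μ))) :
    (Recip.HasReciprocal (Recip.compOp μ φ hφ) ∧
      (∀ f : Lp ℂ 2 μ, f ∈ (Recip.reciprocal (Recip.compOp μ φ hφ)).domain ↔
        MemLp (Recip.condExpCompInv μ hφ f) 2 μ) ∧
      (∀ f : (Recip.reciprocal (Recip.compOp μ φ hφ)).domain,
        (Recip.reciprocal (Recip.compOp μ φ hφ) f : X → ℂ) =ᵐ[μ]
          Recip.condExpCompInv μ hφ f)) ∧
    (Recip.HasReciprocal (Recip.compOp μ φ hφ).adjoint ∧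
      Recip.reciprocal (Recip.compOp μ φ hφ).adjoint =
        Recip.weightedComp μ φ (Recip.recipWeight μ φ)
          (.of_quasi hφ (Recip.measurable_recipWeight hφ.measurable))) := by
  have hh := Recip.ae_hDeriv_lt_top hφ hdense
  have hval : ∀ f : (Recip.reciprocal (Recip.compOp μ φ hφ)).domain,
      (Recip.reciprocal (Recip.compOp μ φ hφ) f : X → ℂ) =ᵐ[μ] Recip.condExpCompInv μ hφ f :=
    fun f => (Recip.mem_graph_reciprocal_compOp_iff hφ hh _ _).1 (LinearPMap.mem_graph _ f)
  refine ⟨⟨Recip.hasReciprocal_compOp hφ, fun f => ⟨fun hf => ?_, fun hf => ?_⟩, hval⟩,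
    Recip.hasReciprocal_adjoint_compOp hφ hdense, Recip.reciprocal_adjoint_compOp hφ hdense⟩
  · exact (memLp_congr_ae (hval ⟨f, hf⟩)).1 (Lp.memLp _)
  · exact LinearPMap.mem_domain_iff.2
      ⟨hf.toLp _, (Recip.mem_graph_reciprocal_compOp_iff hφ hh _ _).2 hf.coeFn_toLp⟩
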